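/- Let $p$ be a prime with $p \equiv 5 \pmod 8$, and consider the integral quaternary quadratic form $$Q_p(x,y,z,w) = x^2+xy+xz+xw+y^2+yz+yw+z^2+zw+\frac{p+3}{8}\,w^2 .$$ A positive integer $n$ is represented by $Q_p$ if $Q_p(x,y,z,w)=n$ for some $x,y,z,w\in\mathbb Z$. A form is called universal if it represents every positive integer, and almost universal if it is not universal but fails to represent only finitely many positive integers. Then $Q_p$ is positive definite, and it represents every positive integer $n$ except exactly those $n < \tfrac p8$ that are of the form $n = 4^k(16\ell+14)$ with integers $k,\ell \ge 0$. In particular, $Q_p$ is almost universal if $p > 112$, and it is universal if $p < 112$. -/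

import Mathlib

/-- The integral form `Q` represents the integer `n`. -/
def Represents (Q : QuadraticForm ℤ (Fin 4 → ℤ)) (n : ℤ) : Prop :=
  ∃ v : Fin 4 → ℤ, Q v = n

/-- `Q` represents every positive integer. -/
def IsUniversalForm (Q : QuadraticForm ℤ (Fin 4 → ℤ)) : Prop :=
  ∀ n : ℕ, 0 < n → Represents Q n

/-- `Q` is not universal, but fails to represent only finitely many positive integers. -/
def IsAlmostUniversalForm (Q : QuadraticForm ℤ (Fin 4 → ℤ)) : Prop :=
  ¬ IsUniversalForm Q ∧ {n : ℕ | 0 < n ∧ ¬ Represents Q n}.Finite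

/-- The form `x² + xy + xz + xw + y² + yz + yw + z² + zw + ((p+3)/8) w²` in the variables
`(x, y, z, w) = (v 0, v 1, v 2, v 3)`. It is used for `p ≡ 5 (mod 8)` only, where the division
by `8` is exact. -/
def familyForm (p : ℕ) : QuadraticForm ℤ (Fin 4 → ℤ) :=
  QuadraticMap.proj 0 0 + QuadraticMap.proj 0 1 + QuadraticMap.proj 0 2 + QuadraticMap.proj 0 3
    + QuadraticMap.proj 1 1 + QuadraticMap.proj 1 2 + QuadraticMap.proj 1 3
    + QuadraticMap.proj 2 2 + QuadraticMap.proj 2 3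
    + (((p + 3) / 8 : ℕ) : ℤ) • QuadraticMap.proj 3 3

theorem familyForm_apply (p : ℕ) (x y z w : ℤ) :
    familyForm p ![x, y, z, w] =
      x ^ 2 + x * y + x * z + x * w + y ^ 2 + y * z + y * w + z ^ 2 + z * w
        + (((p + 3) / 8 : ℕ) : ℤ) * w ^ 2 := by
  simp [familyForm, pow_two]

/-!
With `a = x + y`, `b = x + z`, `c = y + z`, eight times the form equals
`(2a + w)² + (2b + w)² + (2c + w)² + p w²`. Everything then follows from Legendre's three-square
theorem (`Nat.sum_three_squares_iff`).

* If `8n > p`, take `w = 1`: the number `8n - p` is congruent to `3` modulo `8`, so it is a sum of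
  three squares, all odd; choosing signs so that the roots are `1` modulo `4` yields integral
  `x, y, z`.
* If `8n < p`, then `w = 0` is forced, and `n` is represented if and only if `2n` is a sum of three
  squares, that is, if and only if `2n` is not of the form `4 ^ k * (8 * l + 7)`.

The three-square theorem is proved in the classical way. A positive definite integral ternary form
with symmetric integral matrix of determinant `1` takes only sums of three squares as values
(`ternary_form_sum_three_squares`): as long as its leading coefficient exceeds `1`, Hermite's
reduction makes that coefficient smaller. Such a form with value `n` exists as soon as `-d` is a
square modulo `d * n - 1` for some `d > 0` (`sum_three_squares_of_dvd`). For `n ≡ 2 (mod 4)` and for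
odd `n ≢ 7 (mod 8)`, Dirichlet's theorem allows `d * n - 1` to be a prime or twice a prime, and then
quadratic reciprocity evaluates the relevant Jacobi symbol to `1`.
-/

open NumberTheorySymbols

/-! ### Reduction of binary and ternary forms -/

theorem Int.exists_two_mul_abs_add_mul_le (a : ℤ) (ha : 0 < a) (b : ℤ) :
    ∃ t : ℤ, 4 * (b + a * t) ^ 2 ≤ a ^ 2 := by
  have h1 := Int.emod_add_mul_ediv b a
  have h2 := Int.emod_nonneg b ha.ne'
  have h3 := Int.emod_lt_of_pos b ha
  by_cases h : 2 * (b % a) ≤ a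
  · refine ⟨-(b / a), ?_⟩
    have : b + a * -(b / a) = b % a := by linarith
    rw [this]
    nlinarith
  · refine ⟨-(b / a) - 1, ?_⟩
    have : b + a * (-(b / a) - 1) = b % a - a := by linarith
    rw [this]
    nlinarith

/-- Reduction of the positive definite binary form `a x² + 2 b x y + c y²` of determinant `D`: some
unimodular substitution makes its leading coefficient at most `√(4 D / 3)`. -/
theorem binary_form_reduction (D : ℤ) (hD : 0 < D) (a b c : ℤ) (ha : 0 < a)
    (h : a * c - b ^ 2 = D) :
    ∃ p q r s : ℤ, p * s - q * r = 1 ∧ 0 < a * p ^ 2 + 2 * b * p * r + c * r ^ 2 ∧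
      3 * (a * p ^ 2 + 2 * b * p * r + c * r ^ 2) ^ 2 ≤ 4 * D := by
  obtain ⟨t, ht⟩ := Int.exists_two_mul_abs_add_mul_le a ha b
  have hdet : a * (c + 2 * t * b + t ^ 2 * a) - (b + a * t) ^ 2 = D := by rw [← h]; ring
  have hpos : 0 < c + 2 * t * b + t ^ 2 * a := by
    refine pos_of_mul_pos_right (a := a) ?_ ha.le
    nlinarith [sq_nonneg (b + a * t)]
  by_cases hc : a ≤ c + 2 * t * b + t ^ 2 * a
  · refine ⟨1, 0, 0, 1, by norm_num, by simpa using ha, ?_⟩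
    have := mul_le_mul_of_nonneg_left hc ha.le
    norm_num
    nlinarith
  · obtain ⟨p, q, r, s, h1, h2, h3⟩ :=
      binary_form_reduction D hD (c + 2 * t * b + t ^ 2 * a) (b + a * t) a hpos
        (by rw [← hdet]; ring)
    have e : a * (t * p + r) ^ 2 + 2 * b * (t * p + r) * p + c * p ^ 2 =
        (c + 2 * t * b + t ^ 2 * a) * p ^ 2 + 2 * (b + a * t) * p * r + a * r ^ 2 := by ring
    refine ⟨t * p + r, -(t * q + s), p, -q, by linear_combination h1, ?_, ?_⟩
    · rw [e]; exact h2
    · rw [e]; exact h3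
termination_by a.toNat
decreasing_by omega

theorem binary_form_sum_two_squares (a b c : ℤ) (ha : 0 < a) (h : a * c - b ^ 2 = 1) (y z : ℤ) :
    ∃ u v : ℤ, a * y ^ 2 + 2 * b * y * z + c * z ^ 2 = u ^ 2 + v ^ 2 := by
  obtain ⟨p, q, r, s, h1, h2, h3⟩ := binary_form_reduction 1 one_pos a b c ha h
  have hA : a * p ^ 2 + 2 * b * p * r + c * r ^ 2 = 1 := by nlinarith
  -- In the new variables `y' = s y - q z` and `z' = p z - r y` the form is `(y' + B z')² + z'²`.
  refine ⟨(s * y - q * z) + (a * p * q + b * (p * s + q * r) + c * r * s) * (p * z - r * y),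
    p * z - r * y, ?_⟩
  have hB : (a * q ^ 2 + 2 * b * q * s + c * s ^ 2) =
      (a * p * q + b * (p * s + q * r) + c * r * s) ^ 2 + 1 := by
    have : (a * p ^ 2 + 2 * b * p * r + c * r ^ 2) * (a * q ^ 2 + 2 * b * q * s + c * s ^ 2) -
      (a * p * q + b * (p * s + q * r) + c * r * s) ^ 2 =
        (a * c - b ^ 2) * (p * s - q * r) ^ 2 := by ring
    rw [hA, h, h1] at this
    linarith
  have hy : y = p * (s * y - q * z) + q * (p * z - r * y) := by linear_combination -y * h1
  have hz : z = r * (s * y - q * z) + s * (p * z - r * y) := by linear_combination -z * h1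
  generalize s * y - q * z = y' at *
  generalize p * z - r * y = z' at *
  subst hy hz
  linear_combination y' ^ 2 * hA + z' ^ 2 * hB

/-- The estimate behind the descent on ternary forms: with `A = a b - d²`, the bounds on `d` and `A`
would give `27 a³ ≤ 64` if `a ≤ b`. -/
theorem reduced_diagonal_lt {a b d A : ℤ} (ha : 0 < a) (ha1 : a ≠ 1) (hA : a * b - d ^ 2 = A)
    (hd : 4 * d ^ 2 ≤ a ^ 2) (hAa : 3 * A ^ 2 ≤ 4 * a) : b < a := by
  by_contra! hle
  have h4 : a * a ≤ a * b := mul_le_mul_of_nonneg_left hle ha.le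
  have h5 : 3 * a ^ 2 ≤ 4 * A := by linarith [sq a]
  have h6 : (3 * a ^ 2) ^ 2 ≤ (4 * A) ^ 2 := pow_le_pow_left₀ (by positivity) h5 2
  have h7 : a * (27 * a ^ 3) ≤ a * 64 := by
    ring_nf at h6 ⊢
    linarith
  have h8 : 27 * a ^ 3 ≤ 64 := le_of_mul_le_mul_left h7 ha
  have h9 : (2 : ℤ) ^ 3 ≤ a ^ 3 := pow_le_pow_left₀ (by norm_num) (by omega) 3
  linarith

/-- A positive definite ternary form with symmetric integral matrix of determinant `1` takes only
sums of three squares as values. The proof is by descent on the leading coefficient `a`: if `a > 1`,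
reducing the binary form `a F - (a x + d y + e z)²` of determinant `a`, and then `d` modulo `a`,
gives the form a second diagonal coefficient below `a`. -/
theorem ternary_form_sum_three_squares (a b c d e f : ℤ) (ha : 0 < a) (hab : 0 < a * b - d ^ 2)
    (hdet : a * b * c + 2 * d * e * f - a * f ^ 2 - b * e ^ 2 - c * d ^ 2 = 1) (x y z : ℤ) :
    ∃ u v w : ℤ, a * x ^ 2 + b * y ^ 2 + c * z ^ 2 + 2 * d * x * y + 2 * e * x * z + 2 * f * y * z =
      u ^ 2 + v ^ 2 + w ^ 2 := by
  have hG : (a * b - d ^ 2) * (a * c - e ^ 2) - (a * f - d * e) ^ 2 = a := by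
    linear_combination a * hdet
  by_cases ha1 : a = 1
  · subst ha1
    obtain ⟨u, v, huv⟩ := binary_form_sum_two_squares _ _ _ hab hG y z
    exact ⟨x + d * y + e * z, u, v, by linear_combination huv⟩
  · obtain ⟨p, q, r, s, h1, h2, h3⟩ := binary_form_reduction a ha _ _ _ hab hG
    set A := (a * b - d ^ 2) * p ^ 2 + 2 * (a * f - d * e) * p * r + (a * c - e ^ 2) * r ^ 2 with hA
    obtain ⟨t, ht⟩ := Int.exists_two_mul_abs_add_mul_le a ha (d * p + e * r)
    obtain ⟨b', hb'⟩ : ∃ b', b' = b * p ^ 2 + 2 * f * p * r + c * r ^ 2 + 2 * t * (d * p + e * r) +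
      a * t ^ 2 := ⟨_, rfl⟩
    obtain ⟨d', hd'⟩ : ∃ d', d' = d * p + e * r + a * t := ⟨_, rfl⟩
    obtain ⟨e', he'⟩ : ∃ e', e' = d * q + e * s := ⟨_, rfl⟩
    obtain ⟨f', hf'⟩ : ∃ f', f' = b * p * q + f * (p * s + q * r) + c * r * s +
      t * (d * q + e * s) := ⟨_, rfl⟩
    obtain ⟨c', hc'⟩ : ∃ c', c' = b * q ^ 2 + 2 * f * q * s + c * s ^ 2 := ⟨_, rfl⟩
    rw [← hd'] at ht
    have hA' : a * b' - d' ^ 2 = A := by rw [hA, hb', hd']; ring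
    have hb'pos : 0 < b' := by
      refine pos_of_mul_pos_right (a := a) ?_ ha.le
      linarith [sq_nonneg d']
    have hlt : b' < a := reduced_diagonal_lt ha ha1 hA' ht h3
    have hdet' : b' * a * c' + 2 * d' * f' * e' - b' * e' ^ 2 - a * f' ^ 2 - c' * d' ^ 2 = 1 := by
      have : b' * a * c' + 2 * d' * f' * e' - b' * e' ^ 2 - a * f' ^ 2 - c' * d' ^ 2 =
          (a * b * c + 2 * d * e * f - a * f ^ 2 - b * e ^ 2 - c * d ^ 2) *
            (p * s - q * r) ^ 2 := by
        rw [hb', hc', hd', he', hf']; ring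
      rw [this, hdet, h1]; norm_num
    obtain ⟨u, v, w, huvw⟩ := ternary_form_sum_three_squares b' a c' d' f' e' hb'pos
      (by rw [mul_comm, hA']; exact h2) hdet'
      (s * y - q * z) (x - t * (s * y - q * z)) (p * z - r * y)
    refine ⟨u, v, w, ?_⟩
    rw [← huvw]
    have hy : y = p * (s * y - q * z) + q * (p * z - r * y) := by linear_combination -y * h1
    have hz : z = r * (s * y - q * z) + s * (p * z - r * y) := by linear_combination -z * h1
    clear hA h2 h3 huvw hdet hG hdet' hA'
    generalize s * y - q * z = y' at *
    generalize p * z - r * y = z' at *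
    subst hy hz
    rw [hb', hc', hd', he', hf']
    ring
termination_by a.toNat
decreasing_by omega

/-! ### The three-square theorem -/

/-- If `-d` is a square modulo `d * n - 1`, then `n` is a value of a positive definite ternary form
of determinant `1`, hence a sum of three squares. -/
theorem sum_three_squares_of_dvd (n d x : ℤ) (hd : 0 < d) (hn : 0 < d * n - 1)
    (h : d * n - 1 ∣ x ^ 2 + d) : ∃ u v w : ℤ, n = u ^ 2 + v ^ 2 + w ^ 2 := by
  obtain ⟨a, ha⟩ := h
  have hapos : 0 < a := by
    refine pos_of_mul_pos_right (a := d * n - 1) ?_ hn.le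
    nlinarith [sq_nonneg x]
  obtain ⟨u, v, w, h⟩ := ternary_form_sum_three_squares a (d * n - 1) n x 1 0 hapos
    (by linarith) (by linear_combination -n * ha) 0 0 1
  exact ⟨u, v, w, by rw [← h]; ring⟩

theorem exists_dvd_sq_add_of_jacobiSym (q d : ℕ) [Fact q.Prime] (h : J(-(d : ℤ) | q) = 1) :
    ∃ x : ℤ, (q : ℤ) ∣ x ^ 2 + d := by
  obtain ⟨y, hy⟩ := ZMod.isSquare_of_jacobiSym_eq_one h
  obtain ⟨x, rfl⟩ := ZMod.intCast_surjective y
  refine ⟨x, (ZMod.intCast_zmod_eq_zero_iff_dvd _ q).mp ?_⟩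
  push_cast at hy ⊢
  linear_combination -hy

/-- Dirichlet's theorem yields a prime `q = d * n - 1` with `d = 4 * j + 1`; then `q ≡ 1 (mod 4)`, so
that `J(-d | q) = J(q | d) = J(-1 | d) = 1`. -/
theorem sum_three_squares_of_mod_four_eq_two (n : ℕ) (hn : n % 4 = 2) :
    ∃ u v w : ℤ, (n : ℤ) = u ^ 2 + v ^ 2 + w ^ 2 := by
  have hcop : (n - 1).Coprime (4 * n) := by
    refine Nat.Coprime.mul_right ?_ ?_
    · have : (n - 1).Coprime 2 := Nat.coprime_two_right.mpr (Nat.odd_iff.mpr (by omega))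
      exact this.pow_right 2
    · exact Nat.coprime_self_sub_left (by omega) |>.mpr (Nat.coprime_one_left n)
  obtain ⟨q, hq, hqp, hqm⟩ := Nat.forall_exists_prime_gt_and_modEq (4 * n) (by omega) hcop
  have := Fact.mk hqp
  obtain ⟨j, hj⟩ := (Nat.modEq_iff_dvd' (by omega)).mp hqm.symm
  have hqd : q + 1 = (4 * j + 1) * n := by
    have : q = 4 * n * j + (n - 1) := by omega
    rw [this, add_assoc, Nat.sub_add_cancel (by omega)]; ring
  have hq4 : q % 4 = 1 := by
    have : q = 4 * (n * j) + (n - 1) := by rw [← mul_assoc]; omega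
    omega
  have hqd' : ((4 * j + 1 : ℕ) : ℤ) * n - 1 = q := by
    have : ((q + 1 : ℕ) : ℤ) = ((4 * j + 1) * n : ℕ) := by rw [hqd]
    push_cast at this ⊢; linarith
  have hJ : J(-((4 * j + 1 : ℕ) : ℤ) | q) = 1 := by
    rw [jacobiSym.neg _ (Nat.odd_iff.mpr (by omega)), ZMod.χ₄_nat_one_mod_four hq4, one_mul,
      jacobiSym.quadratic_reciprocity_one_mod_four' (Nat.odd_iff.mpr (by omega)) hq4]
    have hm : (q : ℤ) ≡ -1 [ZMOD (4 * j + 1 : ℕ)] := by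
      refine (Int.modEq_iff_dvd.mpr ⟨n, ?_⟩).symm
      rw [← hqd']; ring
    rw [jacobiSym.mod_left' hm, jacobiSym.at_neg_one (Nat.odd_iff.mpr (by omega)),
      ZMod.χ₄_nat_one_mod_four (by omega)]
  obtain ⟨x, hx⟩ := exists_dvd_sq_add_of_jacobiSym q _ hJ
  refine sum_three_squares_of_dvd n (4 * j + 1 : ℕ) x (by positivity) ?_ ?_
  · rw [hqd']; exact_mod_cast hqp.pos
  · rw [hqd']; exact hx

/-- For odd `n ≢ 7 (mod 8)`, with `c = 1` or `c = 3` according to the class of `n`: Dirichlet's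
theorem yields a prime `q` with `2 * q = d * n - 1` and `d = 8 * j + c`, and quadratic reciprocity
yields `J(-d | q) = 1`. -/
theorem sum_three_squares_of_odd_aux (n c : ℕ)
    (hcn : c = 1 ∧ n % 8 = 3 ∨ c = 3 ∧ n % 4 = 1) :
    ∃ u v w : ℤ, (n : ℤ) = u ^ 2 + v ^ 2 + w ^ 2 := by
  obtain ⟨m, hm⟩ : ∃ m, c * n = 2 * m + 1 :=
    ⟨c * n / 2, by rcases hcn with ⟨rfl, h⟩ | ⟨rfl, h⟩ <;> omega⟩
  have hm2 : m % 2 = 1 := by rcases hcn with ⟨rfl, h⟩ | ⟨rfl, h⟩ <;> omega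
  have hcop : m.Coprime (4 * n) := by
    refine Nat.Coprime.mul_right ?_ ?_
    · have : m.Coprime 2 := Nat.coprime_two_right.mpr (Nat.odd_iff.mpr hm2)
      exact this.pow_right 2
    · refine Nat.isCoprime_iff_coprime.mp ⟨-2, c, ?_⟩
      have : ((c * n : ℕ) : ℤ) = (2 * m + 1 : ℕ) := by rw [hm]
      push_cast at this
      linarith
  obtain ⟨q, hq, hqp, hqm⟩ := Nat.forall_exists_prime_gt_and_modEq (m + 2) (by omega) hcop
  have := Fact.mk hqp
  obtain ⟨j, hj⟩ := (Nat.modEq_iff_dvd' (by omega)).mp hqm.symm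
  have hq' : q = 4 * (n * j) + m := by rw [← mul_assoc]; omega
  obtain ⟨d, hd⟩ : ∃ d, d = 8 * j + c := ⟨_, rfl⟩
  have hqd : 2 * q + 1 = d * n := by
    rw [hd, add_mul, hm, hq']; ring
  have hqd' : (d : ℤ) * n - 1 = 2 * q := by
    have : ((2 * q + 1 : ℕ) : ℤ) = (d * n : ℕ) := by rw [hqd]
    push_cast at this; linarith
  have hd2 : Odd d := Nat.odd_iff.mpr (by omega)
  have hq2 : Odd q := Nat.odd_iff.mpr (by omega)
  have hqdJ : J((q : ℤ) | d) = 1 := by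
    have hmod : 2 * (q : ℤ) ≡ -1 [ZMOD d] := by
      refine (Int.modEq_iff_dvd.mpr ⟨n, ?_⟩).symm
      rw [← hqd']; ring
    have h := jacobiSym.mod_left' hmod
    rw [jacobiSym.mul_left, jacobiSym.at_neg_one hd2, jacobiSym.at_two hd2,
      ZMod.χ₈_nat_eq_if_mod_eight, ZMod.χ₄_nat_eq_if_mod_four] at h
    rcases hcn with ⟨hc, -⟩ | ⟨hc, -⟩
    · have h8 : d % 8 = 1 := by omega
      have h4 : d % 4 = 1 := by omega
      have h2 : d % 2 = 1 := by omega
      simpa [h8, h4, h2] using h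
    · have h8 : d % 8 = 3 := by omega
      have h4 : d % 4 = 3 := by omega
      have h2 : d % 2 = 1 := by omega
      simpa [h8, h4, h2] using h
  have hJ : J(-(d : ℤ) | q) = 1 := by
    rw [jacobiSym.neg _ hq2]
    rcases Nat.odd_mod_four_iff.mp (Nat.odd_iff.mp hq2) with h4 | h4
    · rw [ZMod.χ₄_nat_one_mod_four h4, one_mul,
        jacobiSym.quadratic_reciprocity_one_mod_four' hd2 h4, hqdJ]
    · -- Here `m ≡ 3 (mod 4)`, which forces `c = 3`.
      have hd4 : d % 4 = 3 := by rcases hcn with ⟨rfl, h⟩ | ⟨rfl, h⟩ <;> omega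
      rw [ZMod.χ₄_nat_three_mod_four h4,
        jacobiSym.quadratic_reciprocity_three_mod_four hd4 h4, hqdJ]
      norm_num
  obtain ⟨x, hx⟩ := exists_dvd_sq_add_of_jacobiSym q d hJ
  -- Replacing `x` by `x + q` if necessary makes `x` odd, so that `x ^ 2 + d` is even.
  obtain ⟨x, hx, hx2⟩ : ∃ x : ℤ, (q : ℤ) ∣ x ^ 2 + d ∧ Odd x := by
    rcases Int.even_or_odd x with h | h
    · refine ⟨x + q, ?_, h.add_odd (by exact_mod_cast hq2)⟩
      have : (x + q) ^ 2 + d = (x ^ 2 + d) + q * (2 * x + q) := by ring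
      rw [this]
      exact dvd_add hx (dvd_mul_right _ _)
    · exact ⟨x, hx, h⟩
  refine sum_three_squares_of_dvd n d x (by omega) ?_ ?_
  · rw [hqd']; have := hqp.pos; positivity
  · rw [hqd']
    refine IsCoprime.mul_dvd ?_ (hx2.pow.add_odd (by exact_mod_cast hd2)).two_dvd hx
    exact Nat.isCoprime_iff_coprime.mpr (Nat.coprime_two_left.mpr hq2)

theorem sum_three_squares_of_odd (n : ℕ) (hn : n % 2 = 1) (h7 : n % 8 ≠ 7) :
    ∃ u v w : ℤ, (n : ℤ) = u ^ 2 + v ^ 2 + w ^ 2 := by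
  by_cases h3 : n % 8 = 3
  · exact sum_three_squares_of_odd_aux n 1 (.inl ⟨rfl, h3⟩)
  · exact sum_three_squares_of_odd_aux n 3 (.inr ⟨rfl, by omega⟩)

theorem Int.sq_emod_eight (x : ℤ) :
    x % 2 = 0 ∧ x ^ 2 % 4 = 0 ∨ x % 2 = 1 ∧ x ^ 2 % 8 = 1 := by
  rcases Int.even_or_odd' x with ⟨k, rfl | rfl⟩
  · left
    have : (2 * k) ^ 2 = 4 * k ^ 2 := by ring
    omega
  · right
    obtain ⟨m, hm⟩ := Int.even_mul_succ_self k
    have : (2 * k + 1) ^ 2 = 4 * (k * (k + 1)) + 1 := by ring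
    omega

/-- Legendre's three-square theorem. -/
theorem Nat.sum_three_squares_iff (n : ℕ) :
    (∃ u v w : ℤ, (n : ℤ) = u ^ 2 + v ^ 2 + w ^ 2) ↔ ¬ ∃ k l : ℕ, n = 4 ^ k * (8 * l + 7) := by
  constructor
  · rintro ⟨u, v, w, h⟩ ⟨k, l, hkl⟩
    induction k generalizing n u v w with
    | zero =>
      have := Int.sq_emod_eight u
      have := Int.sq_emod_eight v
      have := Int.sq_emod_eight w
      omega
    | succ k ih =>
      -- Modulo `4`, all three squares are even.
      have h4 : n = 4 * (4 ^ k * (8 * l + 7)) := by rw [hkl]; ring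
      have hu := Int.sq_emod_eight u
      have hv := Int.sq_emod_eight v
      have hw := Int.sq_emod_eight w
      obtain ⟨u', rfl⟩ : 2 ∣ u := by omega
      obtain ⟨v', rfl⟩ : 2 ∣ v := by omega
      obtain ⟨w', rfl⟩ : 2 ∣ w := by omega
      refine ih (4 ^ k * (8 * l + 7)) u' v' w' ?_ rfl
      rw [h4] at h
      push_cast at h ⊢
      linarith
  · intro h
    induction n using Nat.strong_induction_on with
    | _ n ih =>
      rcases Nat.eq_zero_or_pos n with rfl | hn
      · exact ⟨0, 0, 0, by norm_num⟩
      by_cases h2 : n % 2 = 1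
      · refine sum_three_squares_of_odd n h2 fun h7 => h ⟨0, n / 8, ?_⟩
        omega
      by_cases h4 : n % 4 = 2
      · exact sum_three_squares_of_mod_four_eq_two n h4
      obtain ⟨m, rfl⟩ : 4 ∣ n := by omega
      obtain ⟨u, v, w, huvw⟩ := ih m (by omega) fun ⟨k, l, hkl⟩ => h ⟨k + 1, l, by rw [hkl]; ring⟩
      exact ⟨2 * u, 2 * v, 2 * w, by push_cast; rw [huvw]; ring⟩

/-! ### The family of quaternary forms -/

theorem exists_sq_eq_four_mul_add_one_sq (u : ℤ) (hu : u % 2 = 1) :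
    ∃ a : ℤ, u ^ 2 = (4 * a + 1) ^ 2 := by
  rcases (by omega : u % 4 = 1 ∨ u % 4 = 3) with h | h
  · exact ⟨u / 4, by congr 1; omega⟩
  · exact ⟨-(u / 4) - 1, by rw [← neg_sq]; congr 1; omega⟩

theorem eight_mul_familyForm (p : ℕ) (hp8 : p % 8 = 5) (x y z w : ℤ) :
    8 * familyForm p ![x, y, z, w] = (2 * (x + y) + w) ^ 2 + (2 * (x + z) + w) ^ 2 +
      (2 * (y + z) + w) ^ 2 + p * w ^ 2 := by
  have h : (p : ℤ) = 8 * ((p + 3) / 8 : ℕ) - 3 := by omega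
  rw [familyForm_apply]
  linear_combination -w ^ 2 * h

theorem familyForm_posDef (p : ℕ) (hp8 : p % 8 = 5) : (familyForm p).PosDef := by
  intro v hv
  have hv4 : v = ![v 0, v 1, v 2, v 3] := by ext i; fin_cases i <;> rfl
  rw [hv4] at hv ⊢
  generalize v 0 = x at *
  generalize v 1 = y at *
  generalize v 2 = z at *
  generalize v 3 = w at *
  have h := eight_mul_familyForm p hp8 x y z w
  have hp : (0 : ℤ) < p := by omega
  by_contra! hle
  have h1 := sq_nonneg (2 * (x + y) + w)
  have h2 := sq_nonneg (2 * (x + z) + w)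
  have h3 := sq_nonneg (2 * (y + z) + w)
  have h4 : 0 ≤ p * w ^ 2 := by positivity
  have hw : w = 0 := by
    have : p * w ^ 2 = 0 := by linarith
    exact pow_eq_zero_iff two_ne_zero |>.mp ((mul_eq_zero.mp this).resolve_left hp.ne')
  have e1 : 2 * (x + y) + w = 0 := pow_eq_zero_iff two_ne_zero |>.mp (by linarith)
  have e2 : 2 * (x + z) + w = 0 := pow_eq_zero_iff two_ne_zero |>.mp (by linarith)
  have e3 : 2 * (y + z) + w = 0 := pow_eq_zero_iff two_ne_zero |>.mp (by linarith)
  obtain rfl : x = 0 := by omega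
  obtain rfl : y = 0 := by omega
  obtain rfl : z = 0 := by omega
  subst hw
  exact hv (by ext i; fin_cases i <;> rfl)

theorem represents_familyForm_of_lt (p n : ℕ) (hp8 : p % 8 = 5) (hn : p < 8 * n) :
    Represents (familyForm p) n := by
  obtain ⟨u, v, w, h⟩ := sum_three_squares_of_odd (8 * n - p) (by omega) (by omega)
  rw [Nat.cast_sub hn.le] at h
  have hu := Int.sq_emod_eight u
  have hv := Int.sq_emod_eight v
  have hw := Int.sq_emod_eight w
  obtain ⟨a, ha⟩ := exists_sq_eq_four_mul_add_one_sq u (by omega)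
  obtain ⟨b, hb⟩ := exists_sq_eq_four_mul_add_one_sq v (by omega)
  obtain ⟨c, hc⟩ := exists_sq_eq_four_mul_add_one_sq w (by omega)
  -- The solution of `x + y = 2 a`, `x + z = 2 b`, `y + z = 2 c`.
  refine ⟨![a + b - c, a + c - b, b + c - a, 1], ?_⟩
  have h8 := eight_mul_familyForm p hp8 (a + b - c) (a + c - b) (b + c - a) 1
  rw [ha, hb, hc] at h
  push_cast at h
  linarith

theorem represents_familyForm_iff_of_lt (p n : ℕ) (hp8 : p % 8 = 5) (hn : 8 * n < p) :
    Represents (familyForm p) n ↔ ∃ u v w : ℤ, ((2 * n : ℕ) : ℤ) = u ^ 2 + v ^ 2 + w ^ 2 := by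
  constructor
  · rintro ⟨v, hv⟩
    have hv4 : v = ![v 0, v 1, v 2, v 3] := by ext i; fin_cases i <;> rfl
    rw [hv4] at hv
    have h8 := eight_mul_familyForm p hp8 (v 0) (v 1) (v 2) (v 3)
    have hw : v 3 = 0 := by
      by_contra hw
      have h1 : 0 < v 3 ^ 2 := by positivity
      have h2 : (p : ℤ) * 1 ≤ p * v 3 ^ 2 := mul_le_mul_of_nonneg_left h1 (by positivity)
      have h3 : (8 * n : ℤ) < p := by exact_mod_cast hn
      linarith [sq_nonneg (2 * (v 0 + v 1) + v 3), sq_nonneg (2 * (v 0 + v 2) + v 3),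
        sq_nonneg (2 * (v 1 + v 2) + v 3)]
    rw [hv, hw] at h8
    refine ⟨v 0 + v 1, v 0 + v 2, v 1 + v 2, ?_⟩
    push_cast
    linarith
  · rintro ⟨a, b, c, h⟩
    -- The sum `a + b + c` is even, which makes `x + y = a`, `x + z = b`, `y + z = c` solvable.
    have ha := Int.sq_emod_eight a
    have hb := Int.sq_emod_eight b
    have hc := Int.sq_emod_eight c
    obtain ⟨x, hx⟩ : 2 ∣ a + b - c := by omega
    have h8 := eight_mul_familyForm p hp8 x (a - x) (b - x) 0
    refine ⟨![x, a - x, b - x, 0], ?_⟩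
    have hc' : a - x + (b - x) = c := by linarith
    rw [hc'] at h8
    push_cast at h
    linarith

theorem two_mul_eq_four_pow_mul_iff (n : ℕ) :
    (∃ k l : ℕ, 2 * n = 4 ^ k * (8 * l + 7)) ↔ ∃ k l : ℕ, n = 4 ^ k * (16 * l + 14) := by
  constructor
  · rintro ⟨_ | k, l, h⟩
    · omega
    · exact ⟨k, l, by rw [pow_succ] at h; linarith⟩
  · rintro ⟨k, l, rfl⟩
    exact ⟨k + 1, l, by ring⟩

theorem represents_familyForm_iff (p n : ℕ) (hp8 : p % 8 = 5) :
    Represents (familyForm p) n ↔ ¬ (8 * n < p ∧ ∃ k l : ℕ, n = 4 ^ k * (16 * l + 14)) := by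
  by_cases hn : 8 * n < p
  · rw [represents_familyForm_iff_of_lt p n hp8 hn, Nat.sum_three_squares_iff,
      two_mul_eq_four_pow_mul_iff]
    simp [hn]
  · simp only [hn, false_and, not_false_eq_true, iff_true]
    exact represents_familyForm_of_lt p n hp8 (by omega)

theorem mainTheorem4 (p : ℕ) (hp : p.Prime) (hp8 : p ≡ 5 [MOD 8]) :
    (familyForm p).PosDef ∧
    (p < 112 → IsUniversalForm (familyForm p)) ∧
    (112 < p → IsAlmostUniversalForm (familyForm p)) ∧
    ∀ n : ℕ, 0 < n →
      (Represents (familyForm p) n ↔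
        ¬ ((n : ℝ) < (p : ℝ) / 8 ∧ ∃ k l : ℕ, n = 4 ^ k * (16 * l + 14))) := by
  have h5 : p % 8 = 5 := hp8
  refine ⟨familyForm_posDef p h5, fun hlt n _ => ?_, fun hgt => ⟨fun h => ?_, ?_⟩, fun n _ => ?_⟩
  · rw [represents_familyForm_iff p n h5]
    rintro ⟨hn, k, l, rfl⟩
    -- Every number of the excluded form is at least `14 = 112 / 8`.
    have : 1 * 14 ≤ 4 ^ k * (16 * l + 14) :=
      Nat.mul_le_mul (Nat.one_le_pow _ _ (by norm_num)) (by omega)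
    omega
  · exact (represents_familyForm_iff p 14 h5).mp (h 14 (by norm_num)) ⟨by omega, 0, 0, by norm_num⟩
  · refine (Set.finite_Iio p).subset fun n ⟨_, hn⟩ => ?_
    rw [represents_familyForm_iff p n h5, not_not] at hn
    have := hn.1
    exact Set.mem_Iio.mpr (by omega)
  · have hcast : (n : ℝ) < (p : ℝ) / 8 ↔ 8 * n < p := by
      rw [lt_div_iff₀ (by norm_num), mul_comm]
      exact_mod_cast Iff.rfl
    rw [represents_familyForm_iff p n h5, hcast]
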